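/- For each integer $n\ge 1$ fix integers $2\le d_{n,1}\le d_{n,2}\le\dots\le d_{n,n}$, and let $X^{(n,1)},\dots,X^{(n,n)}$ be independent real random variables (on a probability space that may depend on $n$) such that $X^{(n,i)}$ is uniformly distributed on $\{0,1,\dots,d_{n,i}-1\}$. Put $X^{(n)}=\sum_{i=1}^n X^{(n,i)}$ and $s_n=\sqrt{\operatorname{Var}(X^{(n)})}$. Then the following three conditions are equivalent as $n\to\infty$: (a) $X^{(n)}$ satisfies the CLT, that is, $(X^{(n)}-\mathbb{E}(X^{(n)}))/s_n$ converges in distribution to the standard normal distribution $N(0,1)$ (pointwise convergence of the cumulative distribution functions at every continuity point of the limiting cumulative distribution function); (b) the maximum condition holds, that is, $\max_{1\le i\le n}\operatorname{Var}(X^{(n,i)})\big/\operatorname{Var}(X^{(n)})\to 0$; (c) $d_{n,n}=o(s_n)$. -/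

import Mathlib

open MeasureTheory ProbabilityTheory Filter Topology

namespace UniformCLT

/-- The set `{0, 1, …, d - 1}`, as a set of real numbers. -/
def intRange (d : ℕ) : Set ℝ := (fun k : ℕ => (k : ℝ)) '' Set.Iio d

/-- Convergence in distribution of real random variables `Y n` (on possibly different probability
spaces) to the distribution `D`: the cumulative distribution functions converge at every point
of continuity of the limiting cumulative distribution function. -/
def ConvergesInDistribution {Ω : ℕ → Type*} [∀ n, MeasurableSpace (Ω n)]
    (P : (n : ℕ) → Measure (Ω n)) (Y : (n : ℕ) → Ω n → ℝ) (D : Measure ℝ) : Prop :=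
  ∀ x : ℝ, ContinuousAt (fun y => cdf D y) x →
    Tendsto (fun n => (P n).real {ω | Y n ω ≤ x}) atTop (𝓝 (cdf D x))

/-- `Y n` satisfies the CLT: `(Y n - 𝔼[Y n]) / √(Var (Y n))` converges in distribution to the
standard normal distribution. -/
def SatisfiesCLT {Ω : ℕ → Type*} [∀ n, MeasurableSpace (Ω n)]
    (P : (n : ℕ) → Measure (Ω n)) (Y : (n : ℕ) → Ω n → ℝ) : Prop :=
  ConvergesInDistribution P
    (fun n ω => (Y n ω - ∫ ω', Y n ω' ∂(P n)) / √(variance (Y n) (P n))) (gaussianReal 0 1)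

/-- The row sums `X n 1 + ⋯ + X n n` of a triangular array. Only the entries `X n i` with
`1 ≤ i ≤ n` belong to the array. -/
def rowSum {Ω : ℕ → Type*} (X : (n : ℕ) → ℕ → Ω n → ℝ) (n : ℕ) : Ω n → ℝ :=
  fun ω => ∑ i ∈ Finset.Icc 1 n, X n i ω

/-- The maximum condition for a triangular array: `max_i Var (X n i) / Var (X n 1 + ⋯ + X n n)`
tends to `0`. The supremum is over the finite set `{1, …, n}`, so it is a maximum for `n ≥ 1`. -/
def MaximumCondition {Ω : ℕ → Type*} [∀ n, MeasurableSpace (Ω n)]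
    (P : (n : ℕ) → Measure (Ω n)) (X : (n : ℕ) → ℕ → Ω n → ℝ) : Prop :=
  Tendsto (fun n => (⨆ i : Finset.Icc 1 n, variance (X n i) (P n)) /
    variance (rowSum X n) (P n)) atTop (𝓝 0)

end UniformCLT

namespace UniformCLT

/-! ### Uniform distributions on initial segments of `ℕ` -/

/-! Everything is read off characteristic functions and `d n n`, the largest size in row `n`. The
largest variance in the row is `((d n n) ^ 2 - 1) / 12`, comparable to `(d n n) ^ 2` because `2 ≤ d
n n`; this makes (b) and (c) equivalent (`maximumCondition_iff_isLittleO`).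

For (c) → (a), the centred summands are bounded by `d n n`. A Taylor expansion of each factor shows
that the characteristic function of the normalized sum is within `2 * |t| ^ 3 * (d n n / s_n)` of
the Gaussian one (`norm_charFun_normalized_sum_sub_exp_le`).

For (a) → (c), the last factor vanishes at `2π / d n n`, since the `d`-th roots of unity sum to
zero; hence the normalized sum has a characteristic function vanishing at `2π s_n / d n n`. If (c)
fails, these zeros have a finite limit point. The characteristic functions are all 1-Lipschitz, so
their limit would vanish there, but `exp (-t ^ 2 / 2)` has no zeros. -/

lemma intRange_eq_coe_image (d : ℕ) :
    intRange d = ((Finset.range d).image (fun k : ℕ => (k : ℝ)) : Finset ℝ) := by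
  simp [intRange]

lemma ae_mem_intRange (d : ℕ) : ∀ᵐ x ∂(uniformOn (intRange d)), x ∈ intRange d := by
  refine ae_cond_mem ?_
  rw [intRange_eq_coe_image]
  exact Finset.measurableSet _

/-- Integration against the uniform distribution on `{0, …, d - 1}` is averaging. -/
lemma integral_uniformOn_intRange {E : Type*} [NormedAddCommGroup E] [NormedSpace ℝ E]
    [CompleteSpace E] (d : ℕ) (f : ℝ → E) :
    ∫ x, f x ∂(uniformOn (intRange d)) = (d : ℝ)⁻¹ • ∑ k ∈ Finset.range d, f k := by
  have hcard : ((Finset.range d).image (fun k : ℕ => (k : ℝ))).card = d := by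
    rw [Finset.card_image_of_injective _ Nat.cast_injective, Finset.card_range]
  rw [uniformOn, ProbabilityTheory.cond, integral_smul_measure, intRange_eq_coe_image,
    setIntegral_finset, Measure.count_apply_finset, hcard, Finset.sum_image]
  · simp [Measure.real]
  · exact Nat.cast_injective.injOn
  · rw [← Set.biUnion_of_singleton
      (((Finset.range d).image (fun k : ℕ => (k : ℝ)) : Finset ℝ) : Set ℝ)]
    simp only [Finset.mem_coe]
    exact integrableOn_finset_iUnion.2 fun x _ =>
      integrableOn_singleton (hx := by rw [Measure.count_singleton]; exact ENNReal.one_lt_top)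

lemma integral_id_uniformOn_intRange {d : ℕ} (hd : d ≠ 0) :
    ∫ x, x ∂(uniformOn (intRange d)) = ((d : ℝ) - 1) / 2 := by
  have h (m : ℕ) : ∑ k ∈ Finset.range m, (k : ℝ) = m * (m - 1) / 2 := by
    induction m with
    | zero => simp
    | succ m ih => rw [Finset.sum_range_succ, ih]; push_cast; ring
  rw [integral_uniformOn_intRange, h, smul_eq_mul]
  field_simp

lemma variance_uniformOn_intRange {d : ℕ} (hd : d ≠ 0) :
    Var[id; uniformOn (intRange d)] = ((d : ℝ) ^ 2 - 1) / 12 := by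
  -- The centre `c` stays free of `m`, so that the induction goes through; the mean is substituted
  -- afterwards.
  have h (c : ℝ) (m : ℕ) : ∑ k ∈ Finset.range m, ((k : ℝ) - c) ^ 2 =
      m * ((m - 1) * (2 * m - 1) / 6 - c * (m - 1) + c ^ 2) := by
    induction m with
    | zero => simp
    | succ m ih => rw [Finset.sum_range_succ, ih]; push_cast; ring
  rw [variance_eq_integral aemeasurable_id]
  simp only [id_eq]
  rw [integral_id_uniformOn_intRange hd, integral_uniformOn_intRange, h, smul_eq_mul]
  field_simp
  ring

/-- The characteristic function of the uniform distribution on `{0, …, d - 1}` vanishes at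
`2 * π / d`. -/
lemma charFun_uniformOn_intRange_eq_zero {d : ℕ} (hd : 2 ≤ d) :
    charFun (uniformOn (intRange d)) (2 * Real.pi / d) = 0 := by
  have hprim := Complex.isPrimitiveRoot_exp d (by omega)
  rw [charFun_apply_real, integral_uniformOn_intRange]
  have hsum := hprim.geom_sum_eq_zero hd
  rw [smul_eq_zero]
  right
  rw [← hsum]
  refine Finset.sum_congr rfl fun k _ => ?_
  rw [← Complex.exp_nat_mul]
  congr 1
  push_cast
  ring

/-! ### Convergence in distribution through characteristic functions -/

lemma tendsto_real_Iic_of_tendsto {ι : Type*} {l : Filter ι} {μ : ι → ProbabilityMeasure ℝ}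
    {ν : ProbabilityMeasure ℝ} [NullSingletonClass (ν : Measure ℝ)] (h : Tendsto μ l (𝓝 ν)) (x : ℝ) :
    Tendsto (fun i => (μ i : Measure ℝ).real (Set.Iic x)) l
      (𝓝 ((ν : Measure ℝ).real (Set.Iic x))) := by
  have := ProbabilityMeasure.tendsto_measure_of_null_frontier_of_tendsto' h
    (E := Set.Iic x) (by simp)
  exact (ENNReal.tendsto_toReal (measure_ne_top _ _)).comp this

/-- Half-open intervals form a π-system containing arbitrarily small neighbourhoods of each point,
and their masses are differences of values of the distribution function. -/
lemma tendsto_of_tendsto_real_Iic {ι : Type*} {l : Filter ι} [l.IsCountablyGenerated]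
    {μ : ι → ProbabilityMeasure ℝ} {ν : ProbabilityMeasure ℝ}
    (h : ∀ x, Tendsto (fun i => (μ i : Measure ℝ).real (Set.Iic x)) l
      (𝓝 ((ν : Measure ℝ).real (Set.Iic x)))) :
    Tendsto μ l (𝓝 ν) := by
  have hIoc (ρ : ProbabilityMeasure ℝ) {a b : ℝ} (hab : a < b) :
      (ρ : Measure ℝ).real (Set.Ioc a b) =
        (ρ : Measure ℝ).real (Set.Iic b) - (ρ : Measure ℝ).real (Set.Iic a) := by
    rw [← Set.Iic_sdiff_Iic, measureReal_sdiff (Set.Iic_subset_Iic.2 hab.le) measurableSet_Iic]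
  refine (isPiSystem_Ioc (id : ℝ → ℝ) id).tendsto_probabilityMeasure_of_tendsto_of_mem ?_ ?_ ?_
  · rintro _ ⟨a, b, -, rfl⟩
    exact measurableSet_Ioc
  · intro u hu x hx
    obtain ⟨ε, hε, hball⟩ := Metric.isOpen_iff.1 hu x hx
    refine ⟨Set.Ioc (x - ε / 2) (x + ε / 2), ⟨_, _, by simp only [id]; linarith, rfl⟩,
      Ioc_mem_nhds (by linarith) (by linarith), fun y hy => hball ?_⟩
    rw [Metric.mem_ball, Real.dist_eq, abs_lt]
    constructor <;> linarith [hy.1, hy.2]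
  · rintro _ ⟨a, b, hab, rfl⟩
    rw [← NNReal.tendsto_coe]
    change Tendsto (fun i => (μ i : Measure ℝ).real (Set.Ioc a b)) l
      (𝓝 ((ν : Measure ℝ).real (Set.Ioc a b)))
    simp only [hIoc _ (show a < b from hab)]
    exact (h b).sub (h a)

/-- Convergence in distribution to a law without atoms is equivalent to pointwise convergence of
the characteristic functions. -/
lemma convergesInDistribution_iff_tendsto_charFun {Ω : ℕ → Type*} [∀ n, MeasurableSpace (Ω n)]
    (P : (n : ℕ) → Measure (Ω n)) [∀ n, IsProbabilityMeasure (P n)] {Y : (n : ℕ) → Ω n → ℝ}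
    (hY : ∀ n, AEMeasurable (Y n) (P n)) (D : Measure ℝ) [IsProbabilityMeasure D] [NullSingletonClass D] :
    ConvergesInDistribution P Y D ↔
      ∀ t, Tendsto (fun n => charFun ((P n).map (Y n)) t) atTop (𝓝 (charFun D t)) := by
  let μ (n : ℕ) : ProbabilityMeasure ℝ :=
    ⟨(P n).map (Y n), Measure.isProbabilityMeasure_map (hY n)⟩
  let ν : ProbabilityMeasure ℝ := ⟨D, inferInstance⟩
  have hatoms : NullSingletonClass (ν : Measure ℝ) := inferInstanceAs (NullSingletonClass D)
  have hIic (n : ℕ) (x : ℝ) :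
      (P n).real {ω | Y n ω ≤ x} = (μ n : Measure ℝ).real (Set.Iic x) :=
    (map_measureReal_apply_of_aemeasurable (hY n) measurableSet_Iic).symm
  -- The jump of the distribution function at `x` is the mass of `{x}`, which is zero.
  have hcont (x : ℝ) : ContinuousAt (fun y => cdf D y) x := by
    have h0 := (cdf D).measure_singleton x
    rw [measure_cdf, measure_singleton] at h0
    rw [(monotone_cdf D).continuousAt_iff_leftLim_eq_rightLim, (cdf D).rightLim_eq]
    refine le_antisymm ((monotone_cdf D).leftLim_le le_rfl) ?_
    linarith [ENNReal.ofReal_eq_zero.1 h0.symm]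
  refine Iff.trans ?_ (ProbabilityMeasure.tendsto_iff_tendsto_charFun (μ := μ) (μ₀ := ν))
  constructor
  · intro h
    refine tendsto_of_tendsto_real_Iic fun x => ?_
    have := h x (hcont x)
    simp only [hIic, cdf_eq_real] at this
    exact this
  · intro h x _
    simp only [hIic, cdf_eq_real]
    exact tendsto_real_Iic_of_tendsto h x

/-! ### Estimates for characteristic functions -/

/-- Factors are exchanged one at a time; the remaining factors lie in the unit disc and cannot
enlarge the error. -/
lemma norm_prod_sub_prod_le_sum {ι : Type*} (s : Finset ι) {a b : ι → ℂ}
    (ha : ∀ i ∈ s, ‖a i‖ ≤ 1) (hb : ∀ i ∈ s, ‖b i‖ ≤ 1) :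
    ‖∏ i ∈ s, a i - ∏ i ∈ s, b i‖ ≤ ∑ i ∈ s, ‖a i - b i‖ := by
  classical
  induction s using Finset.induction with
  | empty => simp
  | insert j s hj ih =>
    rw [Finset.prod_insert hj, Finset.prod_insert hj, Finset.sum_insert hj]
    have h1 : ‖∏ i ∈ s, a i‖ ≤ 1 := by
      rw [norm_prod]
      exact Finset.prod_le_one (fun _ _ => norm_nonneg _)
        fun i hi => ha i (Finset.mem_insert_of_mem hi)
    have h2 := ih (fun i hi => ha i (Finset.mem_insert_of_mem hi))
      (fun i hi => hb i (Finset.mem_insert_of_mem hi))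
    calc ‖a j * ∏ i ∈ s, a i - b j * ∏ i ∈ s, b i‖
        = ‖(a j - b j) * ∏ i ∈ s, a i + b j * (∏ i ∈ s, a i - ∏ i ∈ s, b i)‖ := by
          congr 1; ring
      _ ≤ ‖a j - b j‖ * ‖∏ i ∈ s, a i‖ + ‖b j‖ * ‖∏ i ∈ s, a i - ∏ i ∈ s, b i‖ := by
          rw [← norm_mul, ← norm_mul]; exact norm_add_le _ _
      _ ≤ ‖a j - b j‖ * 1 + 1 * ∑ i ∈ s, ‖a i - b i‖ := by
          gcongr
          exact hb j (Finset.mem_insert_self _ _)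
      _ = _ := by ring

variable {Ω : Type*} [MeasurableSpace Ω] {P : Measure Ω}

lemma charFun_map_apply {Y : Ω → ℝ} (hY : AEMeasurable Y P) (t : ℝ) :
    charFun (P.map Y) t = ∫ ω, Complex.exp (t * Y ω * Complex.I) ∂P := by
  rw [charFun_apply_real, integral_map hY (by fun_prop)]

variable [IsProbabilityMeasure P]

/-- The characteristic function of a bounded centred random variable is close to that of the
Gaussian with the same variance. -/
lemma norm_charFun_sub_exp_le {Y : Ω → ℝ} (hY : AEMeasurable Y P) {B : ℝ}
    (hB : ∀ᵐ ω ∂P, |Y ω| ≤ B) (hmean : ∫ ω, Y ω ∂P = 0) {u : ℝ} (hu : |u| * B ≤ 1) :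
    ‖charFun (P.map Y) u - Complex.exp (-(u ^ 2 * Var[Y; P] / 2))‖ ≤
      2 * (|u| ^ 3 * B * Var[Y; P]) := by
  have hB0 : 0 ≤ B := by
    obtain ⟨ω, hω⟩ := hB.exists
    exact (abs_nonneg _).trans hω
  have hint : Integrable Y P :=
    Integrable.of_bound hY.aestronglyMeasurable B (by simpa using hB)
  have hint2 : Integrable (fun ω => Y ω ^ 2) P := by
    refine Integrable.of_bound (by fun_prop) (B ^ 2) ?_
    filter_upwards [hB] with ω hω
    rw [norm_pow, Real.norm_eq_abs]
    gcongr
  have hvar : Var[Y; P] = ∫ ω, Y ω ^ 2 ∂P := by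
    rw [variance_eq_integral hY, hmean]; simp
  set v := Var[Y; P] with hv
  have hv0 : 0 ≤ v := variance_nonneg _ _
  have hvB : v ≤ B ^ 2 := by
    rw [hvar]
    calc ∫ ω, Y ω ^ 2 ∂P ≤ ∫ _, B ^ 2 ∂P := by
          refine integral_mono_ae hint2 (integrable_const _) ?_
          filter_upwards [hB] with ω hω
          exact sq_le_sq' (by linarith [(abs_le.1 hω).1]) (abs_le.1 hω).2
      _ = B ^ 2 := by simp
  have hexp : Integrable (fun ω => Complex.exp (u * Y ω * Complex.I)) P := by
    refine Integrable.of_bound (by fun_prop) 1 (ae_of_all _ fun ω => ?_)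
    rw [← Complex.ofReal_mul, Complex.norm_exp_ofReal_mul_I]
  have h1 : Integrable (fun ω => (Y ω : ℂ)) P := hint.ofReal
  have h2 : Integrable (fun ω => (Y ω : ℂ) ^ 2) P := by
    simpa using hint2.ofReal (𝕜 := ℂ)
  have hlin : Integrable (fun ω => (1 + u * Y ω * Complex.I : ℂ)) P :=
    (integrable_const 1).add ((h1.const_mul _).mul_const _)
  have hquad : Integrable (fun ω => (u ^ 2 * (Y ω) ^ 2 / 2 : ℂ)) P :=
    (h2.const_mul _).div_const 2
  have hpoly : Integrable (fun ω => (1 + u * Y ω * Complex.I - u ^ 2 * (Y ω) ^ 2 / 2 : ℂ)) P :=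
    hlin.sub hquad
  have hpolyint : ∫ ω, (1 + u * Y ω * Complex.I - u ^ 2 * (Y ω) ^ 2 / 2 : ℂ) ∂P =
      1 - u ^ 2 * v / 2 := by
    have e1 : ∫ ω, (Y ω : ℂ) ∂P = 0 := by rw [integral_complex_ofReal, hmean]; simp
    have e2 : ∫ ω, (Y ω : ℂ) ^ 2 ∂P = v := by
      rw [hvar, ← integral_complex_ofReal]; simp
    rw [integral_sub hlin hquad, integral_add (integrable_const 1)
      ((h1.const_mul _).mul_const _), integral_mul_const, integral_const_mul, integral_div,
      integral_const_mul, e1, e2]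
    simp
  have hfirst : ‖charFun (P.map Y) u - (1 - u ^ 2 * v / 2)‖ ≤ |u| ^ 3 * B * v := by
    rw [charFun_map_apply hY, ← hpolyint, ← integral_sub hexp hpoly]
    refine (norm_integral_le_of_norm_le ((hint2.const_mul (|u| ^ 3 * B))) ?_).trans_eq
      (by rw [integral_const_mul, hvar])
    filter_upwards [hB] with ω hω
    have hx : ‖(u * Y ω * Complex.I : ℂ)‖ = |u| * |Y ω| := by simp
    have hx1 : ‖(u * Y ω * Complex.I : ℂ)‖ ≤ 1 := by
      rw [hx]; exact (by gcongr : |u| * |Y ω| ≤ |u| * B).trans hu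
    have := Complex.exp_bound hx1 (n := 3) (by norm_num)
    have hsum : ∑ m ∈ Finset.range 3, (u * Y ω * Complex.I : ℂ) ^ m / (m.factorial : ℂ) =
        1 + u * Y ω * Complex.I - u ^ 2 * (Y ω) ^ 2 / 2 := by
      simp only [Finset.sum_range_succ, Finset.range_zero, Finset.sum_empty, mul_pow,
        Complex.I_sq, Nat.factorial]
      push_cast
      ring
    rw [hsum, hx] at this
    refine this.trans ?_
    norm_num [Nat.factorial]
    -- The constant `2 / 9` comes from `Complex.exp_bound` at order 3. One factor `|Y ω|` is traded
    -- for `B`, leaving a second moment.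
    calc (|u| * |Y ω|) ^ 3 * (2 / 9) ≤ (|u| * |Y ω|) ^ 3 * 1 := by gcongr; norm_num
      _ = |u| ^ 3 * |Y ω| * |Y ω| ^ 2 := by ring
      _ ≤ |u| ^ 3 * B * |Y ω| ^ 2 := by gcongr
      _ = |u| ^ 3 * B * Y ω ^ 2 := by rw [sq_abs]
  have huB : u ^ 2 * v ≤ (|u| * B) ^ 2 := by
    rw [mul_pow, sq_abs]; gcongr
  have huB1 : (|u| * B) ^ 2 ≤ 1 := pow_le_one₀ (by positivity) hu
  have hsecond : ‖Complex.exp (-(u ^ 2 * v / 2)) - (1 - u ^ 2 * v / 2)‖ ≤ |u| ^ 3 * B * v := by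
    have hnorm : ‖(-(u ^ 2 * v / 2) : ℂ)‖ = u ^ 2 * v / 2 := by
      rw [norm_neg, show (u ^ 2 * v / 2 : ℂ) = ((u ^ 2 * v / 2 : ℝ) : ℂ) by push_cast; rfl,
        Complex.norm_of_nonneg (by positivity)]
    have := Complex.norm_exp_sub_one_sub_id_le (x := (-(u ^ 2 * v / 2) : ℂ))
      (by rw [hnorm]; linarith)
    rw [hnorm] at this
    calc _ = ‖Complex.exp (-(u ^ 2 * v / 2)) - 1 - -(u ^ 2 * v / 2)‖ := by congr 1; ring
      _ ≤ (u ^ 2 * v / 2) ^ 2 := this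
      _ ≤ (u ^ 2 * v) * (u ^ 2 * v) := by nlinarith [sq_nonneg (u ^ 2 * v)]
      -- Here `u ^ 2 * v ≤ (|u| * B) ^ 2 ≤ |u| * B`, because `|u| * B ≤ 1`.
      _ ≤ (u ^ 2 * v) * (|u| * B) := by
          refine mul_le_mul_of_nonneg_left (huB.trans ?_) (by positivity)
          rw [sq]
          exact mul_le_of_le_one_right (by positivity) hu
      _ = |u| ^ 3 * B * v := by rw [← sq_abs u]; ring
  calc _ = ‖(charFun (P.map Y) u - (1 - u ^ 2 * v / 2)) -
        (Complex.exp (-(u ^ 2 * v / 2)) - (1 - u ^ 2 * v / 2))‖ := by congr 1; ring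
    _ ≤ _ := norm_sub_le _ _
    _ ≤ _ := by linarith

/-- The characteristic function of a random variable with second moment at most `1` is
`1`-Lipschitz. -/
lemma norm_charFun_sub_le {Y : Ω → ℝ} (hY : MemLp Y 2 P) (hsq : ∫ ω, Y ω ^ 2 ∂P ≤ 1)
    (t u : ℝ) : ‖charFun (P.map Y) t - charFun (P.map Y) u‖ ≤ |t - u| := by
  have hYm := hY.aestronglyMeasurable.aemeasurable
  have hint2 : Integrable (fun ω => Y ω ^ 2) P := hY.integrable_sq
  have hexp (t : ℝ) : Integrable (fun ω => Complex.exp (t * Y ω * Complex.I)) P := by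
    refine Integrable.of_bound (by fun_prop) 1 (ae_of_all _ fun ω => ?_)
    rw [← Complex.ofReal_mul, Complex.norm_exp_ofReal_mul_I]
  rw [charFun_map_apply hYm, charFun_map_apply hYm, ← integral_sub (hexp t) (hexp u)]
  -- The bound is `|Y| ≤ (1 + Y ^ 2) / 2`, whose mean is at most 1.
  have hbound : Integrable (fun ω => |t - u| * ((1 + Y ω ^ 2) / 2)) P :=
    (((integrable_const (1 : ℝ)).add hint2).div_const 2).const_mul _
  refine (norm_integral_le_of_norm_le hbound (ae_of_all _ fun ω => ?_)).trans ?_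
  · have h1 : Complex.exp (t * Y ω * Complex.I) - Complex.exp (u * Y ω * Complex.I) =
        Complex.exp ((u * Y ω : ℝ) * Complex.I) *
          (Complex.exp (Complex.I * ((t - u) * Y ω : ℝ)) - 1) := by
      rw [mul_sub, ← Complex.exp_add, mul_one]
      congr 2
      · push_cast; ring
      · push_cast; ring
    rw [h1, norm_mul, Complex.norm_exp_ofReal_mul_I, one_mul]
    refine Real.norm_exp_I_mul_ofReal_sub_one_le.trans ?_
    rw [Real.norm_eq_abs, abs_mul]
    gcongr
    rw [← sq_abs (Y ω)]
    nlinarith [sq_nonneg (|Y ω| - 1)]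
  · rw [integral_const_mul, integral_div, integral_add (integrable_const _) hint2]
    refine mul_le_of_le_one_right (abs_nonneg _) ?_
    simp only [integral_const, probReal_univ, smul_eq_mul, one_mul]
    linarith

/-- Quantitative central limit theorem, on the level of characteristic functions, for sums of
independent, bounded and centred random variables. -/
lemma norm_charFun_normalized_sum_sub_exp_le {ι : Type*} {s : Finset ι} {Y : ι → Ω → ℝ}
    (hYm : ∀ i ∈ s, AEMeasurable (Y i) P) (hindep : iIndepFun (s.restrict Y) P) {B : ℝ}
    (hB : ∀ i ∈ s, ∀ᵐ ω ∂P, |Y i ω| ≤ B) (hmean : ∀ i ∈ s, ∫ ω, Y i ω ∂P = 0)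
    {σ : ℝ} (hσ : 0 < σ) (hvar : ∑ i ∈ s, Var[Y i; P] = σ ^ 2) {t : ℝ} (ht : |t| * B ≤ σ) :
    ‖charFun (P.map fun ω => σ⁻¹ * ∑ i ∈ s, Y i ω) t - Complex.exp (-(t ^ 2 / 2))‖ ≤
      2 * |t| ^ 3 * (B / σ) := by
  have hu : |σ⁻¹ * t| = |t| / σ := by
    rw [abs_mul, abs_of_pos (inv_pos.2 hσ), div_eq_inv_mul]
  -- The variances add up to `σ ^ 2`, so the Gaussian splits into one factor per summand.
  have hprod : Complex.exp (-(t ^ 2 / 2)) =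
      ∏ i ∈ s, Complex.exp (-(((σ⁻¹ * t : ℝ) : ℂ) ^ 2 * Var[Y i; P] / 2)) := by
    rw [← Complex.exp_sum, Finset.sum_neg_distrib, ← Finset.sum_div, ← Finset.mul_sum,
      ← Complex.ofReal_sum, hvar]
    have : (σ : ℂ) ≠ 0 := by exact_mod_cast hσ.ne'
    congr 2
    push_cast
    field_simp
  rw [charFun_map_mul_comp (Finset.aemeasurable_fun_sum _ hYm),
    hindep.charFun_map_fun_finsetSum_eq_prod hYm, Finset.prod_apply, hprod]
  refine (norm_prod_sub_prod_le_sum s (fun i hi => ?_) fun i _ => ?_).trans ?_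
  · have := Measure.isProbabilityMeasure_map (hYm i hi)
    exact norm_charFun_le_one _
  · rw [Complex.norm_exp]
    have : (-(((σ⁻¹ * t : ℝ) : ℂ) ^ 2 * Var[Y i; P] / 2)).re =
        -((σ⁻¹ * t) ^ 2 * Var[Y i; P] / 2) := by norm_cast
    rw [this, Real.exp_le_one_iff]
    have := variance_nonneg (Y i) P
    have : 0 ≤ (σ⁻¹ * t) ^ 2 * Var[Y i; P] / 2 := by positivity
    linarith
  · calc _ ≤ ∑ i ∈ s, 2 * (|σ⁻¹ * t| ^ 3 * B * Var[Y i; P]) := by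
          refine Finset.sum_le_sum fun i hi => ?_
          refine norm_charFun_sub_exp_le (hYm i hi) (hB i hi) (hmean i hi) ?_
          rw [hu, div_mul_eq_mul_div]
          exact (div_le_one hσ).2 ht
      _ = 2 * |t| ^ 3 * (B / σ) := by
          rw [← Finset.mul_sum, ← Finset.mul_sum, hvar, hu]
          field_simp

/-! ### Uniform random variables -/

section Uniform

variable {Ω : Type*} [MeasurableSpace Ω] {P : Measure Ω}
  {Y : Ω → ℝ} {d : ℕ}

lemma integral_eq_of_hasLaw_uniformOn (hd : d ≠ 0) (hY : HasLaw Y (uniformOn (intRange d)) P) :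
    ∫ ω, Y ω ∂P = ((d : ℝ) - 1) / 2 := by
  rw [hY.integral_eq, integral_id_uniformOn_intRange hd]

lemma variance_eq_of_hasLaw_uniformOn (hd : d ≠ 0) (hY : HasLaw Y (uniformOn (intRange d)) P) :
    Var[Y; P] = ((d : ℝ) ^ 2 - 1) / 12 := by
  rw [hY.variance_eq, variance_uniformOn_intRange hd]

lemma ae_mem_Icc_of_hasLaw_uniformOn (hY : HasLaw Y (uniformOn (intRange d)) P) :
    ∀ᵐ ω ∂P, Y ω ∈ Set.Icc (0 : ℝ) (d - 1) := by
  have h := ae_mem_intRange d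
  rw [← hY.map_eq] at h
  filter_upwards [ae_of_ae_map hY.aemeasurable h] with ω hω
  obtain ⟨k, hk, hkω⟩ := hω
  have hk' : k + 1 ≤ d := hk
  have hk'' : (k : ℝ) + 1 ≤ d := by exact_mod_cast hk'
  rw [← hkω]
  exact ⟨Nat.cast_nonneg k, le_sub_iff_add_le.2 hk''⟩

/-- Translation only multiplies the characteristic function by a phase, so its zeros survive
centring. -/
lemma charFun_sub_const_eq_zero_of_hasLaw_uniformOn (hd : 2 ≤ d)
    (hY : HasLaw Y (uniformOn (intRange d)) P) (c : ℝ) :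
    charFun (P.map fun ω => Y ω - c) (2 * Real.pi / d) = 0 := by
  have : P.map (fun ω => Y ω - c) = (P.map Y).map (· + -c) := by
    rw [AEMeasurable.map_map_of_aemeasurable (by fun_prop) hY.aemeasurable]
    rfl
  rw [this, charFun_map_add_const, hY.map_eq, charFun_uniformOn_intRange_eq_zero hd, zero_mul]

lemma ae_abs_sub_integral_le_of_hasLaw_uniformOn (hd : d ≠ 0)
    (hY : HasLaw Y (uniformOn (intRange d)) P) :
    ∀ᵐ ω ∂P, |Y ω - ∫ ω', Y ω' ∂P| ≤ d := by
  have hd1 : (1 : ℝ) ≤ d := by exact_mod_cast Nat.one_le_iff_ne_zero.2 hd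
  rw [integral_eq_of_hasLaw_uniformOn hd hY]
  filter_upwards [ae_mem_Icc_of_hasLaw_uniformOn hY] with ω hω
  rw [abs_le]
  constructor <;> linarith [hω.1, hω.2]

variable [IsProbabilityMeasure P]

lemma memLp_two_of_hasLaw_uniformOn (hY : HasLaw Y (uniformOn (intRange d)) P) : MemLp Y 2 P := by
  refine MemLp.of_bound hY.aemeasurable.aestronglyMeasurable ((d : ℝ) - 1) ?_
  filter_upwards [ae_mem_Icc_of_hasLaw_uniformOn hY] with ω hω
  rw [Real.norm_eq_abs, abs_of_nonneg hω.1]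
  exact hω.2

end Uniform

/-! ### Sums of independent uniform random variables -/

/-- The random variables `X 1, …, X n` are independent, and `X i` is uniformly distributed on
`{0, …, d i - 1}`, where `2 ≤ d 1 ≤ ⋯ ≤ d n`. -/
structure IsUniformRow {Ω : Type*} [MeasurableSpace Ω] (P : Measure Ω) (n : ℕ) (d : ℕ → ℕ)
    (X : ℕ → Ω → ℝ) : Prop where
  two_le : ∀ i ∈ Set.Icc 1 n, 2 ≤ d i
  mono : MonotoneOn d (Set.Icc 1 n)
  indep : iIndepFun (fun i : Finset.Icc 1 n => X i) P
  law : ∀ i ∈ Set.Icc 1 n, HasLaw (X i) (uniformOn (intRange (d i))) P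

namespace IsUniformRow

variable {Ω : Type*} [MeasurableSpace Ω] {P : Measure Ω} {n : ℕ} {d : ℕ → ℕ}
  {X : ℕ → Ω → ℝ}

lemma ne_zero (h : IsUniformRow P n d X) {i : ℕ} (hi : i ∈ Set.Icc 1 n) : d i ≠ 0 := by
  have := h.two_le i hi
  omega

lemma le_last (h : IsUniformRow P n d X) {i : ℕ} (hi : i ∈ Set.Icc 1 n) : d i ≤ d n :=
  h.mono hi ⟨hi.1.trans hi.2, le_rfl⟩ hi.2

lemma variance_eq (h : IsUniformRow P n d X) {i : ℕ} (hi : i ∈ Set.Icc 1 n) :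
    Var[X i; P] = ((d i : ℝ) ^ 2 - 1) / 12 :=
  variance_eq_of_hasLaw_uniformOn (h.ne_zero hi) (h.law i hi)

lemma variance_pos (h : IsUniformRow P n d X) {i : ℕ} (hi : i ∈ Set.Icc 1 n) :
    0 < Var[X i; P] := by
  have : (2 : ℝ) ≤ d i := by exact_mod_cast h.two_le i hi
  rw [h.variance_eq hi]
  nlinarith

lemma iSup_variance_eq (h : IsUniformRow P n d X) (hn : 1 ≤ n) :
    ⨆ i : Finset.Icc 1 n, Var[X i; P] = ((d n : ℝ) ^ 2 - 1) / 12 := by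
  have hmem : n ∈ Finset.Icc 1 n := by simpa using hn
  have : Nonempty (Finset.Icc 1 n) := ⟨⟨n, hmem⟩⟩
  have hle (i : Finset.Icc 1 n) : Var[X i; P] ≤ ((d n : ℝ) ^ 2 - 1) / 12 := by
    have hi : (i : ℕ) ∈ Set.Icc 1 n := Finset.mem_Icc.1 i.2
    have : (d i : ℝ) ≤ d n := by exact_mod_cast h.le_last hi
    rw [h.variance_eq hi]
    gcongr
  refine le_antisymm (ciSup_le hle) ?_
  rw [← h.variance_eq (i := n) (by simpa using hn)]
  exact le_ciSup (f := fun i : Finset.Icc 1 n => Var[X i; P])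
    ⟨_, Set.forall_mem_range.2 hle⟩ ⟨n, hmem⟩

lemma aemeasurable_sum (h : IsUniformRow P n d X) :
    AEMeasurable (fun ω => ∑ i ∈ Finset.Icc 1 n, X i ω) P :=
  Finset.aemeasurable_fun_sum _ fun i hi => (h.law i (by simpa using hi)).aemeasurable

lemma indep_sub_integral (h : IsUniformRow P n d X) :
    iIndepFun ((Finset.Icc 1 n).restrict fun i ω => X i ω - ∫ ω', X i ω' ∂P) P :=
  h.indep.comp (fun i x => x - ∫ ω', X i ω' ∂P) fun _ => by fun_prop

variable [IsProbabilityMeasure P]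

lemma memLp (h : IsUniformRow P n d X) {i : ℕ} (hi : i ∈ Set.Icc 1 n) : MemLp (X i) 2 P :=
  memLp_two_of_hasLaw_uniformOn (h.law i hi)

lemma variance_sum_eq (h : IsUniformRow P n d X) :
    Var[fun ω => ∑ i ∈ Finset.Icc 1 n, X i ω; P] = ∑ i ∈ Finset.Icc 1 n, Var[X i; P] := by
  have := IndepFun.variance_sum (X := X) (s := Finset.Icc 1 n) (μ := P)
    (fun i hi => h.memLp (by simpa using hi))
    (fun i hi j hj hij => h.indep.indepFun (i := ⟨i, hi⟩) (j := ⟨j, hj⟩) (by simpa using hij))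
  rw [← this]
  congr 1
  ext ω
  simp

lemma variance_sum_pos (h : IsUniformRow P n d X) (hn : 1 ≤ n) :
    0 < Var[fun ω => ∑ i ∈ Finset.Icc 1 n, X i ω; P] := by
  rw [h.variance_sum_eq]
  exact Finset.sum_pos (fun i hi => h.variance_pos (by simpa using hi)) ⟨1, by simpa using hn⟩

lemma memLp_sum (h : IsUniformRow P n d X) :
    MemLp (fun ω => ∑ i ∈ Finset.Icc 1 n, X i ω) 2 P :=
  memLp_finsetSum _ fun i hi => h.memLp (by simpa using hi)

lemma normalized_sum_eq (h : IsUniformRow P n d X) (σ : ℝ) :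
    (fun ω => (∑ i ∈ Finset.Icc 1 n, X i ω - ∫ ω', ∑ i ∈ Finset.Icc 1 n, X i ω' ∂P) / σ) =
      fun ω => σ⁻¹ * ∑ i ∈ Finset.Icc 1 n, (X i ω - ∫ ω', X i ω' ∂P) := by
  rw [integral_finsetSum _ fun i hi => (h.memLp (by simpa using hi)).integrable one_le_two]
  ext ω
  rw [Finset.sum_sub_distrib, div_eq_inv_mul]

lemma norm_charFun_sub_exp_le (h : IsUniformRow P n d X) {σ : ℝ} (hσ : 0 < σ)
    (hvar : Var[fun ω => ∑ i ∈ Finset.Icc 1 n, X i ω; P] = σ ^ 2) {t : ℝ}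
    (ht : |t| * d n ≤ σ) :
    ‖charFun (P.map fun ω =>
        (∑ i ∈ Finset.Icc 1 n, X i ω - ∫ ω', ∑ i ∈ Finset.Icc 1 n, X i ω' ∂P) / σ) t -
      Complex.exp (-(t ^ 2 / 2))‖ ≤ 2 * |t| ^ 3 * (d n / σ) := by
  rw [h.normalized_sum_eq]
  refine norm_charFun_normalized_sum_sub_exp_le
    (Y := fun i ω => X i ω - ∫ ω', X i ω' ∂P) (fun i hi => ?_)
    h.indep_sub_integral (fun i hi => ?_) (fun i hi => ?_) hσ ?_ ht
  · exact (h.law i (by simpa using hi)).aemeasurable.sub_const _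
  · have hi' : i ∈ Set.Icc 1 n := by simpa using hi
    have hle : (d i : ℝ) ≤ d n := by exact_mod_cast h.le_last hi'
    filter_upwards [ae_abs_sub_integral_le_of_hasLaw_uniformOn (h.ne_zero hi') (h.law i hi')]
      with ω hω
    exact hω.trans hle
  · rw [integral_sub ((h.memLp (by simpa using hi)).integrable one_le_two) (integrable_const _)]
    simp
  · rw [← hvar, h.variance_sum_eq]
    refine Finset.sum_congr rfl fun i hi => ?_
    exact variance_sub_const (h.memLp (by simpa using hi)).aestronglyMeasurable _

/-- By independence a zero of the factor of index `n` is a zero of the product; the argument is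
rescaled by `σ`. -/
lemma charFun_eq_zero (h : IsUniformRow P n d X) (hn : 1 ≤ n) {σ : ℝ} (hσ : 0 < σ) :
    charFun (P.map fun ω =>
        (∑ i ∈ Finset.Icc 1 n, X i ω - ∫ ω', ∑ i ∈ Finset.Icc 1 n, X i ω' ∂P) / σ)
      (2 * Real.pi * (σ / d n)) = 0 := by
  have hm (i) (hi : i ∈ Finset.Icc 1 n) : AEMeasurable (fun ω => X i ω - ∫ ω', X i ω' ∂P) P :=
    (h.law i (by simpa using hi)).aemeasurable.sub_const _
  have hmem : n ∈ Set.Icc 1 n := by simpa using hn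
  rw [h.normalized_sum_eq, charFun_map_mul_comp (Finset.aemeasurable_fun_sum _ hm),
    (h.indep_sub_integral).charFun_map_fun_finsetSum_eq_prod hm, Finset.prod_apply]
  refine Finset.prod_eq_zero (i := n) (by simpa using hn) ?_
  rw [show σ⁻¹ * (2 * Real.pi * (σ / d n)) = 2 * Real.pi / d n by field_simp]
  exact charFun_sub_const_eq_zero_of_hasLaw_uniformOn (h.two_le n hmem) (h.law n hmem) _

lemma norm_charFun_sub_le (h : IsUniformRow P n d X) {σ : ℝ} (hσ : 0 < σ)
    (hvar : Var[fun ω => ∑ i ∈ Finset.Icc 1 n, X i ω; P] = σ ^ 2) (t u : ℝ) :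
    ‖charFun (P.map fun ω =>
        (∑ i ∈ Finset.Icc 1 n, X i ω - ∫ ω', ∑ i ∈ Finset.Icc 1 n, X i ω' ∂P) / σ) t -
      charFun (P.map fun ω =>
        (∑ i ∈ Finset.Icc 1 n, X i ω - ∫ ω', ∑ i ∈ Finset.Icc 1 n, X i ω' ∂P) / σ) u‖ ≤
      |t - u| := by
  refine UniformCLT.norm_charFun_sub_le ?_ (le_of_eq ?_) t u
  · simp only [div_eq_mul_inv]
    exact (h.memLp_sum.sub (memLp_const _)).mul_const _
  · simp only [div_pow]
    rw [integral_div, ← variance_eq_integral h.aemeasurable_sum, hvar,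
      div_self (by positivity)]

end IsUniformRow

/-! ### The three conditions for triangular arrays -/

section Array

variable {Ω : ℕ → Type*} [∀ n, MeasurableSpace (Ω n)] {P : (n : ℕ) → Measure (Ω n)}
  [∀ n, IsProbabilityMeasure (P n)] {d : ℕ → ℕ → ℕ} {X : (n : ℕ) → ℕ → Ω n → ℝ}

lemma satisfiesCLT_iff_tendsto_charFun (h : ∀ n, IsUniformRow (P n) n (d n) (X n)) :
    SatisfiesCLT P (rowSum X) ↔ ∀ t : ℝ, Tendsto (fun n => charFun ((P n).map fun ω =>
      (rowSum X n ω - ∫ ω', rowSum X n ω' ∂(P n)) / √(Var[rowSum X n; P n])) t)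
      atTop (𝓝 (Complex.exp (-(t ^ 2 / 2)))) := by
  have hatoms : NullSingletonClass (gaussianReal 0 1) := nullSingletonClass_gaussianReal one_ne_zero
  have hmeas (n : ℕ) : AEMeasurable (rowSum X n) (P n) := (h n).aemeasurable_sum
  rw [SatisfiesCLT, convergesInDistribution_iff_tendsto_charFun P
    (fun n => ((hmeas n).sub_const _).div_const _)]
  simp [charFun_gaussianReal]

lemma satisfiesCLT_of_isLittleO (h : ∀ n, IsUniformRow (P n) n (d n) (X n))
    (hd : (fun n => (d n n : ℝ)) =o[atTop] fun n => √(Var[rowSum X n; P n])) :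
    SatisfiesCLT P (rowSum X) := by
  rw [satisfiesCLT_iff_tendsto_charFun h]
  intro t
  rw [tendsto_iff_norm_sub_tendsto_zero]
  have hlim : Tendsto (fun n => 2 * |t| ^ 3 * (d n n / √(Var[rowSum X n; P n]))) atTop (𝓝 0) := by
    simpa using hd.tendsto_div_nhds_zero.const_mul (2 * |t| ^ 3)
  refine squeeze_zero' (Eventually.of_forall fun _ => norm_nonneg _) ?_ hlim
  -- Adding 1 covers `t = 0`; eventually `|t| * d n n ≤ s_n`, as the quantitative estimate requires.
  have hpos : (0 : ℝ) < (|t| + 1)⁻¹ := by positivity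
  filter_upwards [hd.bound hpos, eventually_ge_atTop 1] with n hn h1
  have hV := (h n).variance_sum_pos h1
  refine (h n).norm_charFun_sub_exp_le (Real.sqrt_pos.2 hV) (Real.sq_sqrt hV.le).symm ?_
  rw [Real.norm_of_nonneg (by positivity), Real.norm_of_nonneg (by positivity),
    inv_mul_eq_div, le_div_iff₀ (by positivity)] at hn
  have : (0 : ℝ) ≤ d n n := by positivity
  calc |t| * d n n ≤ d n n * (|t| + 1) := by nlinarith
    _ ≤ _ := hn

lemma isLittleO_of_satisfiesCLT (h : ∀ n, IsUniformRow (P n) n (d n) (X n))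
    (hclt : SatisfiesCLT P (rowSum X)) :
    (fun n => (d n n : ℝ)) =o[atTop] fun n => √(Var[rowSum X n; P n]) := by
  rw [satisfiesCLT_iff_tendsto_charFun h] at hclt
  refine Asymptotics.isLittleO_iff.2 fun c hc => ?_
  by_contra hfreq
  rw [not_eventually] at hfreq
  -- Where `c * s_n < d n n`, the zero `2π s_n / d n n` lies in a fixed compact interval.
  have hfreq' : ∃ᶠ n in atTop, 2 * Real.pi * (√(Var[rowSum X n; P n]) / d n n) ∈
      Set.Icc 0 (2 * Real.pi * c⁻¹) := by
    refine (hfreq.and_eventually (eventually_ge_atTop 1)).mono fun n ⟨hn, h1⟩ => ?_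
    have hdn : (0 : ℝ) < d n n := by
      exact_mod_cast Nat.pos_of_ne_zero ((h n).ne_zero (i := n) (by simpa using h1))
    rw [not_le, Real.norm_of_nonneg (by positivity), Real.norm_of_nonneg (by positivity)] at hn
    refine ⟨by positivity, ?_⟩
    gcongr
    rw [div_le_iff₀ hdn, inv_mul_eq_div, le_div_iff₀ hc]
    linarith
  obtain ⟨t, -, φ, hφ, ht⟩ := isCompact_Icc.tendsto_subseq' hfreq'
  have hzero : Tendsto (fun k => charFun ((P (φ k)).map fun ω =>
      (rowSum X (φ k) ω - ∫ ω', rowSum X (φ k) ω' ∂(P (φ k))) /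
        √(Var[rowSum X (φ k); P (φ k)])) t) atTop (𝓝 0) := by
    rw [tendsto_zero_iff_norm_tendsto_zero]
    -- By the Lipschitz bound, the value at `t` is at most the distance from `t` to the zero of row
    -- `φ k`.
    have hlim := (tendsto_const_nhds (x := t)).sub ht |>.abs
    rw [sub_self, abs_zero] at hlim
    refine squeeze_zero' (Eventually.of_forall fun _ => norm_nonneg _) ?_ hlim
    filter_upwards [hφ.tendsto_atTop.eventually_ge_atTop 1] with k h1
    have hV : 0 < Var[rowSum X (φ k); P (φ k)] := (h (φ k)).variance_sum_pos h1
    have hσ := Real.sqrt_pos.2 hV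
    have hle := (h (φ k)).norm_charFun_sub_le hσ (Real.sq_sqrt hV.le).symm t
      (2 * Real.pi * (√(Var[rowSum X (φ k); P (φ k)]) / d (φ k) (φ k)))
    rw [(h (φ k)).charFun_eq_zero h1 hσ, sub_zero] at hle
    exact hle
  exact Complex.exp_ne_zero _
    (tendsto_nhds_unique ((hclt t).comp hφ.tendsto_atTop) hzero)

lemma maximumCondition_iff_isLittleO (h : ∀ n, IsUniformRow (P n) n (d n) (X n)) :
    MaximumCondition P X ↔
      (fun n => (d n n : ℝ)) =o[atTop] fun n => √(Var[rowSum X n; P n]) := by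
  have hsq : ((fun n => (d n n : ℝ)) =o[atTop] fun n => √(Var[rowSum X n; P n])) ↔
      Tendsto (fun n => (d n n : ℝ) ^ 2 / Var[rowSum X n; P n]) atTop (𝓝 0) := by
    rw [Asymptotics.isLittleO_iff_tendsto']
    · have heq : (fun n => (d n n : ℝ) ^ 2 / Var[rowSum X n; P n]) =
          fun n => (d n n / √(Var[rowSum X n; P n])) ^ 2 := by
        ext n
        rw [div_pow, Real.sq_sqrt (variance_nonneg _ _)]
      rw [heq]
      refine ⟨fun hlim => by simpa using hlim.pow 2, fun hlim => ?_⟩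
      have := hlim.sqrt
      simp only [Real.sqrt_zero] at this
      refine this.congr fun n => Real.sqrt_sq (by positivity)
    -- Row 0 is excluded: its sum is empty, with variance 0, and `d 0 0` is arbitrary.
    · filter_upwards [eventually_ge_atTop 1] with n h1 h0
      exact absurd h0 (Real.sqrt_pos.2 ((h n).variance_sum_pos h1)).ne'
  rw [hsq, MaximumCondition]
  have hV (n : ℕ) : 0 ≤ Var[rowSum X n; P n] := variance_nonneg _ _
  constructor
  · intro hlim
    -- The inequality `d ^ 2 ≤ 16 * ((d ^ 2 - 1) / 12)` is equivalent to `4 ≤ d ^ 2`, with equality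
    -- at `d = 2`.
    have hlim16 := hlim.const_mul 16
    rw [mul_zero] at hlim16
    refine squeeze_zero' (Eventually.of_forall fun n => div_nonneg (sq_nonneg _) (hV n)) ?_ hlim16
    filter_upwards [eventually_ge_atTop 1] with n h1
    have h2 : (2 : ℝ) ≤ d n n := by exact_mod_cast (h n).two_le n (by simpa using h1)
    rw [(h n).iSup_variance_eq h1, ← mul_div_assoc]
    exact div_le_div_of_nonneg_right (by nlinarith) (hV n)
  · intro hlim
    refine squeeze_zero' ?_ ?_ hlim
    · filter_upwards [eventually_ge_atTop 1] with n h1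
      have h2 : (2 : ℝ) ≤ d n n := by exact_mod_cast (h n).two_le n (by simpa using h1)
      rw [(h n).iSup_variance_eq h1]
      exact div_nonneg (by nlinarith) (hV n)
    · filter_upwards [eventually_ge_atTop 1] with n h1
      rw [(h n).iSup_variance_eq h1]
      exact div_le_div_of_nonneg_right (by nlinarith) (hV n)

end Array

end UniformCLT

theorem proposition6p9
    {Ω : ℕ → Type*} [∀ n, MeasurableSpace (Ω n)]
    (P : (n : ℕ) → Measure (Ω n)) [∀ n, IsProbabilityMeasure (P n)]
    (d : ℕ → ℕ → ℕ)
    (hd_two : ∀ n, ∀ i ∈ Set.Icc 1 n, 2 ≤ d n i)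
    (hd_mono : ∀ n, MonotoneOn (d n) (Set.Icc 1 n))
    (X : (n : ℕ) → ℕ → Ω n → ℝ)
    (hX_indep : ∀ n, iIndepFun (fun i : Finset.Icc 1 n => X n i) (P n))
    (hX_law : ∀ n, ∀ i ∈ Set.Icc 1 n,
      HasLaw (X n i) (uniformOn (UniformCLT.intRange (d n i))) (P n)) :
    (UniformCLT.SatisfiesCLT P (UniformCLT.rowSum X) ↔ UniformCLT.MaximumCondition P X) ∧
    (UniformCLT.MaximumCondition P X ↔
      Asymptotics.IsLittleO atTop (fun n => (d n n : ℝ))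
        (fun n => √(variance (UniformCLT.rowSum X n) (P n)))) := by
  have h (n : ℕ) : UniformCLT.IsUniformRow (P n) n (d n) (X n) :=
    ⟨hd_two n, hd_mono n, hX_indep n, hX_law n⟩
  have hmax := UniformCLT.maximumCondition_iff_isLittleO h
  exact ⟨⟨fun hclt => hmax.2 (UniformCLT.isLittleO_of_satisfiesCLT h hclt),
    fun hm => UniformCLT.satisfiesCLT_of_isLittleO h (hmax.1 hm)⟩, hmax⟩
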